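/- Let $N\ge 3$. Let $V:(0,+\infty)\to[0,+\infty]$ be measurable, finite almost everywhere, with $V\in L^1((r_1,r_2))$ for some $r_2>r_1>0$, and let $K:(0,+\infty)\to(0,+\infty)$ be measurable with $K\in L^s_{\mathrm{loc}}((0,+\infty))$ for some $s>\frac{2N}{N+2}$. Let $D^{1,2}(\mathbb R^N)=\{u\in L^{2N/(N-2)}(\mathbb R^N):\nabla u\in L^2(\mathbb R^N)\}$ and $$H^1_V=\Big\{u\in D^{1,2}(\mathbb R^N):\int_{\mathbb R^N}V(|x|)u^2\,dx<\infty\Big\},\qquad \|u\|^2=\int_{\mathbb R^N}\big(|\nabla u|^2+V(|x|)u^2\big)\,dx,$$ and let $H^1_{V,\mathrm r}$ be the closure in $H^1_V$ of the set of radial $u\in C^\infty_{\mathrm c}(\mathbb R^N)$ with $\int_{\mathbb R^N} V(|x|)u^2\,dx<\infty$. For $q>1$ and $R>0$ set $$\mathcal R_\infty(q,R)=\sup_{u\in H^1_{V,\mathrm r},\ h\in H^1_V,\ \|u\|=\|h\|=1}\ \int_{\{|x|\ge R\}}K(|x|)\,|u|^{q-1}|h|\,dx\in[0,+\infty].$$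 Assume that there are $R_2>0$, $0\le\beta_\infty\le1$, $\alpha_\infty\in\mathbb R$ and $\gamma_\infty\le2$ such that $$\operatorname*{ess\,sup}_{r>R_2}\frac{K(r)}{r^{\alpha_\infty}V(r)^{\beta_\infty}}<+\infty\qquad\text{and}\qquad \operatorname*{ess\,inf}_{r>R_2}\,r^{\gamma_\infty}V(r)>0,$$ with the convention $V(r)^0=1$. Then $\lim_{R\to+\infty}\mathcal R_\infty(q_2,R)=0$ for every $q_2\in\mathbb R$ with $q_2>\max\{1,2\beta_\infty,q_*,q_{**}\}$, where $$q_*=2\,\frac{\alpha_\infty-\gamma_\infty\beta_\infty+N}{N-\gamma_\infty},\qquad q_{**}=2\,\frac{2\alpha_\infty+(1-2\beta_\infty)\gamma_\infty+2(N-1)}{2(N-1)-\gamma_\infty}.$$ -/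

import Mathlib

open MeasureTheory Filter Topology Set
open scoped ENNReal

namespace RadialSobolev

/-- The space `ℝ^N` with its Euclidean norm. -/
abbrev E (N : ℕ) : Type := EuclideanSpace ℝ (Fin N)

/-- Real `C^∞` functions with compact support in `ℝ^N`. -/
def IsTestFunction {N : ℕ} (φ : E N → ℝ) : Prop :=
  ContDiff ℝ (⊤ : ℕ∞) φ ∧ HasCompactSupport φ

/-- `u` is radial: its value at `x` depends on `‖x‖` only. -/
def IsRadial {N : ℕ} (u : E N → ℝ) : Prop :=
  ∀ x y : E N, ‖x‖ = ‖y‖ → u x = u y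

/-- `G` is the distributional gradient of `u` on `ℝ^N`. -/
def HasWeakGradient {N : ℕ} (u : E N → ℝ) (G : E N → E N) : Prop :=
  LocallyIntegrable u volume ∧ LocallyIntegrable G volume ∧
    ∀ φ : E N → ℝ, IsTestFunction φ → ∀ v : E N,
      ∫ x, u x * fderiv ℝ φ x v = - ∫ x, inner ℝ (G x) v * φ x

open Classical in
/-- The weak gradient of `u` (determined up to null sets; `0` if there is none). -/
noncomputable def weakGradient {N : ℕ} (u : E N → ℝ) : E N → E N :=
  if h : ∃ G : E N → E N, HasWeakGradient u G then h.choose else 0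

/-- `u ∈ D^{1,2}(ℝ^N)`: `u ∈ L^{2^*}`, `2^* = 2N/(N-2)`, with weak gradient in `L^2`. -/
def MemD12 {N : ℕ} (u : E N → ℝ) : Prop :=
  MemLp u (ENNReal.ofReal (2 * (N : ℝ) / ((N : ℝ) - 2))) volume ∧
    (∃ G : E N → E N, HasWeakGradient u G) ∧ MemLp (weakGradient u) 2 volume

/-- `∫ V(|x|) u² dx`. -/
noncomputable def potentialEnergy {N : ℕ} (V : ℝ → ℝ≥0∞) (u : E N → ℝ) : ℝ≥0∞ :=
  ∫⁻ x, V ‖x‖ * ‖u x‖ₑ ^ 2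

/-- `‖u‖ = (∫ (|∇u|² + V(|x|) u²) dx)^{1/2}`. -/
noncomputable def hNorm {N : ℕ} (V : ℝ → ℝ≥0∞) (u : E N → ℝ) : ℝ≥0∞ :=
  (∫⁻ x, (‖weakGradient u x‖ₑ ^ 2 + V ‖x‖ * ‖u x‖ₑ ^ 2)) ^ (1 / 2 : ℝ)

/-- `u ∈ H^1_V`. -/
def MemH {N : ℕ} (V : ℝ → ℝ≥0∞) (u : E N → ℝ) : Prop :=
  MemD12 u ∧ potentialEnergy V u < ∞

/-- `u ∈ H^1_{V,r}`: the closure in `H^1_V` of the radial test functions of finite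
potential energy. -/
def MemHrad {N : ℕ} (V : ℝ → ℝ≥0∞) (u : E N → ℝ) : Prop :=
  MemH V u ∧ ∀ ε : ℝ≥0∞, 0 < ε →
    ∃ φ : E N → ℝ, IsTestFunction φ ∧ IsRadial φ ∧ potentialEnergy V φ < ∞ ∧
      hNorm V (u - φ) < ε

/-- `𝓡_∞(q, R)`, with values in `[0, ∞]`. -/
noncomputable def Rinfty (N : ℕ) (V : ℝ → ℝ≥0∞) (K : ℝ → ℝ) (q R : ℝ) : ℝ≥0∞ :=
  ⨆ (u : E N → ℝ) (h : E N → ℝ) (_ : MemHrad V u) (_ : MemH V h)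
    (_ : hNorm V u = 1) (_ : hNorm V h = 1),
    ∫⁻ x in (Metric.ball (0 : E N) R)ᶜ,
      ENNReal.ofReal (K ‖x‖) * ‖u x‖ₑ ^ (q - 1) * ‖h x‖ₑ

/-- `V : (0, ∞) → [0, ∞]` is (Lebesgue) measurable and `V ∈ L^1((r₁, r₂))` for some
`r₂ > r₁ > 0`. Values of `V` outside `(0, ∞)` are irrelevant. -/
def AssumptionV (V : ℝ → ℝ≥0∞) : Prop :=
  AEMeasurable V (volume.restrict (Ioi 0)) ∧
    ∃ r₁ r₂ : ℝ, 0 < r₁ ∧ r₁ < r₂ ∧ ∫⁻ r in Ioo r₁ r₂, V r < ∞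

/-- `K : (0, ∞) → (0, ∞)` is (Lebesgue) measurable and `K ∈ L^s_loc((0, ∞))` for some
`s > 2N/(N+2)`. Values of `K` outside `(0, ∞)` are irrelevant. -/
def AssumptionK (N : ℕ) (K : ℝ → ℝ) : Prop :=
  (∀ r : ℝ, 0 < r → 0 < K r) ∧ AEMeasurable K (volume.restrict (Ioi 0)) ∧
    ∃ s : ℝ, 2 * (N : ℝ) / ((N : ℝ) + 2) < s ∧
      ∀ C : Set ℝ, IsCompact C → C ⊆ Ioi 0 →
        MemLp K (ENNReal.ofReal s) (volume.restrict C)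

/-- `q_*(α, β, γ)` in dimension `N`. -/
noncomputable def qStar (N : ℕ) (α β γ : ℝ) : ℝ :=
  2 * ((α - γ * β + N) / (N - γ))

/-- `q_{**}(α, β, γ)` in dimension `N`. -/
noncomputable def qStarStar (N : ℕ) (α β γ : ℝ) : ℝ :=
  2 * ((2 * α + (1 - 2 * β) * γ + 2 * ((N : ℝ) - 1)) / (2 * ((N : ℝ) - 1) - γ))

end RadialSobolev

namespace RadialSobolev

/-- Polar coordinates for the lower Lebesgue integral of a function of the norm. -/
lemma lintegral_fun_norm {N : ℕ} {f : ℝ → ℝ≥0∞} (hN : 0 < N) (hf : Measurable f) :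
    ∫⁻ x : E N, f ‖x‖ = (volume : Measure (E N)).toSphere univ *
      ∫⁻ r in Ioi (0 : ℝ), ENNReal.ofReal (r ^ (N - 1)) * f r := by
  have : Nonempty (Fin N) := ⟨⟨0, hN⟩⟩
  have hd : Module.finrank ℝ (E N) = N := by simp
  have h0 : ∫⁻ x : E N, f ‖x‖ = ∫⁻ x : ({0}ᶜ : Set (E N)), f ‖x.1‖
      ∂(volume.comap Subtype.val) := by
    rw [lintegral_subtype_comap (measurableSet_singleton _).compl (fun x : E N => f ‖x‖),
      Measure.restrict_eq_self_of_ae_mem]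
    simp [ae_iff]
  rw [h0]
  have h1 := (volume : Measure (E N)).measurePreserving_homeomorphUnitSphereProd.lintegral_comp
    (f := fun p => f p.2.1) (by fun_prop)
  simp only [homeomorphUnitSphereProd_apply_snd_coe] at h1
  rw [h1, lintegral_prod _ (by fun_prop)]
  simp only [lintegral_const]
  rw [mul_comm, Measure.volumeIoiPow, lintegral_withDensity_eq_lintegral_mul _ (by fun_prop)
    (by fun_prop), hd]
  simp only [Pi.mul_apply]
  rw [lintegral_subtype_comap measurableSet_Ioi
    (fun r : ℝ => ENNReal.ofReal (r ^ (N - 1)) * f r)]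

/-- The norm pulls back null sets of `(0, ∞)` to null sets. -/
lemma ae_norm_of_ae_Ioi {N : ℕ} (hN : 0 < N) {p : ℝ → Prop} {a : ℝ}
    (h : ∀ᵐ r ∂(volume.restrict (Ioi a)), p r) :
    ∀ᵐ x : E N, a < ‖x‖ → p ‖x‖ := by
  rw [ae_restrict_iff' measurableSet_Ioi] at h
  set T := toMeasurable volume {r : ℝ | ¬ (r ∈ Ioi a → p r)} with hT
  have hT0 : volume T = 0 := by rw [hT, measure_toMeasurable]; exact ae_iff.1 h
  have hTm : MeasurableSet T := measurableSet_toMeasurable _ _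
  have hi : ∫⁻ x : E N, T.indicator (fun _ => (1 : ℝ≥0∞)) ‖x‖ = 0 := by
    rw [lintegral_fun_norm hN (measurable_const.indicator hTm)]
    convert mul_zero _
    rw [lintegral_eq_zero_iff (by
      exact (by fun_prop : Measurable fun r : ℝ => ENNReal.ofReal (r ^ (N - 1))).mul
        (measurable_const.indicator hTm))]
    apply ae_restrict_of_ae
    have : ∀ᵐ r : ℝ, r ∉ T := measure_eq_zero_iff_ae_notMem.1 hT0
    filter_upwards [this] with r hr
    simp [hr]
  replace hi := (lintegral_eq_zero_iff
    ((measurable_const.indicator hTm).comp measurable_norm)).1 hi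
  filter_upwards [hi] with x hx hax
  by_contra hp
  have hmem : ‖x‖ ∈ T := subset_toMeasurable _ _ (by simpa using ⟨hax, hp⟩)
  simp [hmem] at hx

/-- A measurable profile on `(0, ∞)` gives a measurable radial function. -/
lemma aemeasurable_comp_norm {N : ℕ} (hN : 0 < N) {V : ℝ → ℝ≥0∞}
    (hV : AEMeasurable V (volume.restrict (Ioi 0))) :
    AEMeasurable (fun x : E N => V ‖x‖) volume := by
  have : Nonempty (Fin N) := ⟨⟨0, hN⟩⟩
  have h := ae_norm_of_ae_Ioi hN hV.ae_eq_mk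
  refine ⟨fun x => hV.mk V ‖x‖, hV.measurable_mk.comp measurable_norm, ?_⟩
  have h0 : ∀ᵐ x : E N, x ≠ 0 := by simp [ae_iff]
  filter_upwards [h, h0] with x hx hx0
  exact hx (norm_pos_iff.2 hx0)

lemma IsTestFunction.continuous {N : ℕ} {φ : E N → ℝ} (h : IsTestFunction φ) : Continuous φ :=
  h.1.continuous

lemma IsTestFunction.continuous_fderiv {N : ℕ} {φ : E N → ℝ} (h : IsTestFunction φ) :
    Continuous (fderiv ℝ φ) :=
  h.1.continuous_fderiv (by simp)

lemma IsTestFunction.differentiable {N : ℕ} {φ : E N → ℝ} (h : IsTestFunction φ) :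
    Differentiable ℝ φ :=
  h.1.differentiable (by simp)

lemma IsTestFunction.continuous_gradient {N : ℕ} {φ : E N → ℝ} (h : IsTestFunction φ) :
    Continuous (gradient φ) :=
  (InnerProductSpace.toDual ℝ (E N)).symm.continuous.comp h.continuous_fderiv

lemma norm_gradient {N : ℕ} (φ : E N → ℝ) (x : E N) : ‖gradient φ x‖ = ‖fderiv ℝ φ x‖ := by
  simp [gradient]

/-- The classical gradient of a test function is its weak gradient. -/
lemma IsTestFunction.hasWeakGradient {N : ℕ} {φ : E N → ℝ} (h : IsTestFunction φ) :
    HasWeakGradient φ (gradient φ) := by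
  refine ⟨h.continuous.locallyIntegrable, h.continuous_gradient.locallyIntegrable, ?_⟩
  intro ψ hψ v
  have hi : ∀ x, inner ℝ (gradient φ x) v = fderiv ℝ φ x v := fun x => by
    simp [gradient]
  simp only [hi]
  have cφ := h.continuous
  have cφ' : Continuous fun x => fderiv ℝ φ x v := h.continuous_fderiv.clm_apply continuous_const
  have cψ := hψ.continuous
  have cψ' : Continuous fun x => fderiv ℝ ψ x v := hψ.continuous_fderiv.clm_apply continuous_const
  apply integral_mul_fderiv_eq_neg_fderiv_mul_of_integrable
  · exact (cφ'.mul cψ).integrable_of_hasCompactSupport hψ.2.mul_left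
  · exact (cφ.mul cψ').integrable_of_hasCompactSupport h.2.mul_right
  · exact (cφ.mul cψ).integrable_of_hasCompactSupport h.2.mul_right
  · exact fun x _ => h.differentiable x
  · exact fun x _ => hψ.differentiable x

lemma integrable_mul_of_locallyIntegrable {N : ℕ} {u g : E N → ℝ}
    (hu : LocallyIntegrable u volume) (hg : Continuous g) (hc : HasCompactSupport g) :
    Integrable (fun x => u x * g x) volume := by
  have := hu.integrable_smul_right_of_hasCompactSupport hg hc
  simpa using this

lemma locallyIntegrable_inner {N : ℕ} {G : E N → E N} (hG : LocallyIntegrable G volume) (v : E N) :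
    LocallyIntegrable (fun x => inner ℝ (G x) v) volume := by
  intro x
  obtain ⟨s, hs, hi⟩ := hG x
  exact ⟨s, hs, hi.inner_const v⟩

lemma HasWeakGradient.sub {N : ℕ} {u w : E N → ℝ} {G H : E N → E N}
    (hu : HasWeakGradient u G) (hw : HasWeakGradient w H) : HasWeakGradient (u - w) (G - H) := by
  refine ⟨hu.1.sub hw.1, hu.2.1.sub hw.2.1, ?_⟩
  intro φ hφ v
  have cφ' : Continuous fun x => fderiv ℝ φ x v := hφ.continuous_fderiv.clm_apply continuous_const
  have kφ' : HasCompactSupport fun x => fderiv ℝ φ x v := hφ.2.fderiv_apply ℝ v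
  simp only [Pi.sub_apply, sub_mul, inner_sub_left]
  rw [integral_sub (integrable_mul_of_locallyIntegrable hu.1 cφ' kφ')
      (integrable_mul_of_locallyIntegrable hw.1 cφ' kφ'),
    integral_sub (integrable_mul_of_locallyIntegrable (locallyIntegrable_inner hu.2.1 v)
      hφ.continuous hφ.2)
      (integrable_mul_of_locallyIntegrable (locallyIntegrable_inner hw.2.1 v) hφ.continuous hφ.2),
    hu.2.2 φ hφ v, hw.2.2 φ hφ v]
  ring

/-- Weak gradients are unique up to null sets. -/
lemma HasWeakGradient.ae_eq {N : ℕ} {u : E N → ℝ} {G H : E N → E N}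
    (hG : HasWeakGradient u G) (hH : HasWeakGradient u H) : G =ᵐ[volume] H := by
  have key : ∀ i : Fin N, ∀ᵐ x, G x i = H x i := by
    intro i
    have e : ∀ F : E N → E N, ∀ x, F x i = inner ℝ (F x) (EuclideanSpace.single i (1 : ℝ)) := by
      intro F x; simp [EuclideanSpace.inner_single_right]
    simp only [e G, e H]
    refine ae_eq_of_integral_contDiff_smul_eq (locallyIntegrable_inner hG.2.1 _)
      (locallyIntegrable_inner hH.2.1 _) ?_
    intro g hg hgc
    have h1 := hG.2.2 g ⟨hg, hgc⟩ (EuclideanSpace.single i (1 : ℝ))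
    have h2 := hH.2.2 g ⟨hg, hgc⟩ (EuclideanSpace.single i (1 : ℝ))
    simp only [smul_eq_mul, mul_comm (g _)]
    linarith
  filter_upwards [ae_all_iff.2 key] with x hx
  ext i
  exact hx i

lemma hasWeakGradient_weakGradient {N : ℕ} {u : E N → ℝ}
    (h : ∃ G : E N → E N, HasWeakGradient u G) : HasWeakGradient u (weakGradient u) := by
  rw [weakGradient, dif_pos h]
  exact h.choose_spec

lemma weakGradient_sub_ae {N : ℕ} {u φ : E N → ℝ} (h : ∃ G : E N → E N, HasWeakGradient u G)
    (hφ : IsTestFunction φ) :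
    weakGradient (u - φ) =ᵐ[volume] fun x => weakGradient u x - gradient φ x := by
  have h1 := (hasWeakGradient_weakGradient h).sub hφ.hasWeakGradient
  exact (hasWeakGradient_weakGradient ⟨_, h1⟩).ae_eq h1

/-- One-dimensional decay estimate for a compactly supported `C^1` profile. -/
lemma profile_decay {f : ℝ → ℝ} (hf : ContDiff ℝ 1 f) (hc : HasCompactSupport f) {n : ℕ}
    {γ r : ℝ} (hr : 0 < r) (ha : 0 ≤ n - γ / 2) :
    ENNReal.ofReal (r ^ (n - γ / 2) * f r ^ 2) ≤
      ∫⁻ s in Ioi r, ENNReal.ofReal (s ^ n) *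
        ENNReal.ofReal (deriv f s ^ 2 + s ^ (-γ) * f s ^ 2) := by
  obtain ⟨M, hM, hrM⟩ : ∃ M, f M = 0 ∧ r < M := by
    obtain ⟨B, hB⟩ := hc.isCompact.bddAbove
    refine ⟨max B r + 1, ?_, by linarith [le_max_right B r]⟩
    by_contra h
    have := hB (subset_tsupport f h)
    linarith [le_max_left B r]
  set a : ℝ := n - γ / 2 with ha_def
  have hfc := hf.continuous
  have hf' : Continuous (deriv f) := hf.continuous_deriv le_rfl
  have pos : ∀ s ∈ uIcc r M, 0 < s := fun s hs => by
    rw [uIcc_of_le hrM.le] at hs; exact hr.trans_le hs.1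
  have hrp : ∀ p : ℝ, ContinuousOn (fun s : ℝ => s ^ p) (uIcc r M) := fun p =>
    continuousOn_id.rpow_const fun s hs => Or.inl (pos s hs).ne'
  set g' : ℝ → ℝ := fun s => a * s ^ (a - 1) * f s ^ 2 + s ^ a * (2 * f s * deriv f s)
  have hd : ∀ s ∈ uIcc r M, HasDerivAt (fun s => s ^ a * f s ^ 2) (g' s) s := by
    intro s hs
    have h1 := Real.hasDerivAt_rpow_const (p := a) (Or.inl (pos s hs).ne')
    have h2 := ((hf.differentiable one_ne_zero s).hasDerivAt).pow 2
    refine (h1.mul h2).congr_deriv ?_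
    simp [g']
  have cg' : ContinuousOn g' (uIcc r M) :=
    ((continuousOn_const.mul (hrp _)).mul (hfc.pow 2).continuousOn).add
      ((hrp _).mul (by fun_prop))
  have cF : ContinuousOn (fun s => s ^ n * (deriv f s ^ 2 + s ^ (-γ) * f s ^ 2)) (uIcc r M) :=
    (by fun_prop : Continuous fun s : ℝ => s ^ n).continuousOn.mul
      ((hf'.pow 2).continuousOn.add ((hrp _).mul (hfc.pow 2).continuousOn))
  have hint := intervalIntegral.integral_eq_sub_of_hasDerivAt hd cg'.intervalIntegrable
  have hle : r ^ a * f r ^ 2 ≤ ∫ s in r..M, s ^ n * (deriv f s ^ 2 + s ^ (-γ) * f s ^ 2) := by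
    have : r ^ a * f r ^ 2 = ∫ s in r..M, - g' s := by
      rw [intervalIntegral.integral_neg, hint, hM]; ring
    rw [this]
    refine intervalIntegral.integral_mono_on hrM.le cg'.neg.intervalIntegrable
      cF.intervalIntegrable ?_
    intro s hs
    have hs0 : 0 < s := hr.trans_le hs.1
    have e1 : s ^ n = (s ^ ((n : ℝ) / 2)) ^ 2 := by
      rw [← Real.rpow_natCast, ← Real.rpow_natCast, ← Real.rpow_mul hs0.le]; congr 1; push_cast; ring
    have e2 : s ^ (-γ) = (s ^ (-γ / 2)) ^ 2 := by
      rw [← Real.rpow_natCast, ← Real.rpow_mul hs0.le]; congr 1; push_cast; ring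
    have e3 : s ^ a = (s ^ ((n : ℝ) / 2)) ^ 2 * s ^ (-γ / 2) := by
      rw [ha_def, sub_eq_add_neg, Real.rpow_add hs0, ← neg_div]
      congr 1
      rw [Real.rpow_natCast, e1]
    have h1 : 0 ≤ a * s ^ (a - 1) * f s ^ 2 := by positivity
    have h2 := mul_nonneg (sq_nonneg (s ^ ((n : ℝ) / 2)))
      (sq_nonneg (deriv f s + s ^ (-γ / 2) * f s))
    simp only [g']
    rw [e1, e2, e3]
    nlinarith [h1, h2]
  have hnn : ∀ s, 0 < s → 0 ≤ s ^ n * (deriv f s ^ 2 + s ^ (-γ) * f s ^ 2) := fun s hs => by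
    positivity
  refine (ENNReal.ofReal_le_ofReal hle).trans ?_
  rw [intervalIntegral.integral_of_le hrM.le, ofReal_integral_eq_lintegral_ofReal]
  · refine (lintegral_mono_set Ioc_subset_Ioi_self).trans (le_of_eq ?_)
    refine setLIntegral_congr_fun measurableSet_Ioi fun s hs => ?_
    rw [ENNReal.ofReal_mul (pow_nonneg (hr.trans hs).le _)]
  · exact cF.intervalIntegrable.1
  · filter_upwards [ae_restrict_mem measurableSet_Ioc] with s hs
    exact hnn s (hr.trans hs.1)

/-- Pointwise decay of radial test functions under a power lower bound on the potential. -/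
lemma IsTestFunction.radial_decay {N : ℕ} (hN : 3 ≤ N) {V : ℝ → ℝ≥0∞} {R₂ γ c : ℝ}
    (hR₂ : 0 < R₂) (hγ : γ ≤ 2) (hc : 0 < c) (hc1 : c ≤ 1)
    (hV : ∀ᵐ x : E N, R₂ < ‖x‖ → ENNReal.ofReal (c * ‖x‖ ^ (-γ)) ≤ V ‖x‖)
    {φ : E N → ℝ} (hφ : IsTestFunction φ) (hrad : IsRadial φ) {x : E N} (hx : R₂ < ‖x‖) :
    (volume : Measure (E N)).toSphere univ *
      ENNReal.ofReal (c * (‖x‖ ^ (N - 1 - γ / 2) * φ x ^ 2)) ≤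
      ∫⁻ y, (‖gradient φ y‖ₑ ^ 2 + V ‖y‖ * ‖φ y‖ₑ ^ 2) := by
  have hx0 : 0 < ‖x‖ := hR₂.trans hx
  set e : E N := (‖x‖⁻¹ : ℝ) • x with he
  have hen : ‖e‖ = 1 := by rw [he, norm_smul]; simp [hx0.ne']
  set f : ℝ → ℝ := fun s => φ (s • e) with hfdef
  have hφf : ∀ y, φ y = f ‖y‖ := fun y => hrad _ _ (by simp [norm_smul, hen])
  have hf : ContDiff ℝ 1 f := (hφ.1.of_le (by simp)).comp (by fun_prop)
  have hfc : HasCompactSupport f := by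
    obtain ⟨B, hB⟩ := hφ.2.isCompact.isBounded.exists_norm_le
    refine HasCompactSupport.intro (isCompact_Icc (a := -B) (b := B)) fun s hs => ?_
    by_contra h
    have := hB _ (subset_tsupport φ h)
    rw [norm_smul, hen, mul_one, Real.norm_eq_abs, abs_le] at this
    exact hs this
  have hgrad : ∀ y : E N, y ≠ 0 → |deriv f ‖y‖| ≤ ‖gradient φ y‖ := by
    intro y hy
    have hy0 : 0 < ‖y‖ := norm_pos_iff.2 hy
    set d : E N := (‖y‖⁻¹ : ℝ) • y with hddef
    have hdn : ‖d‖ = 1 := by rw [hddef, norm_smul]; simp [hy0.ne']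
    have hfd : f = fun s => φ (s • d) := by
      funext s; exact hrad _ _ (by simp [norm_smul, hen, hdn])
    have hyd : ‖y‖ • d = y := by rw [hddef, smul_smul]; simp [hy0.ne']
    have h1 : HasDerivAt (fun s : ℝ => s • d) d ‖y‖ := by
      simpa using (hasDerivAt_id ‖y‖).smul_const d
    have h2 : HasFDerivAt φ (fderiv ℝ φ y) (‖y‖ • d) := by
      rw [hyd]; exact (hφ.differentiable y).hasFDerivAt
    have h3 := h2.comp_hasDerivAt _ h1
    have h4 : deriv f ‖y‖ = fderiv ℝ φ y d := by rw [hfd]; exact h3.deriv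
    rw [h4, norm_gradient, ← Real.norm_eq_abs]
    simpa [hdn] using (fderiv ℝ φ y).le_opNorm d
  set F : ℝ → ℝ≥0∞ := (Ioi ‖x‖).indicator fun s =>
    ENNReal.ofReal c * ENNReal.ofReal (deriv f s ^ 2 + s ^ (-γ) * f s ^ 2) with hF
  have hf' : Continuous (deriv f) := hf.continuous_deriv le_rfl
  have hFm : Measurable F := by
    refine Measurable.indicator ?_ measurableSet_Ioi
    have := hf.continuous.measurable
    have := hf'.measurable
    fun_prop
  have hstep : ∫⁻ y : E N, F ‖y‖ ≤ ∫⁻ y, (‖gradient φ y‖ₑ ^ 2 + V ‖y‖ * ‖φ y‖ₑ ^ 2) := by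
    refine lintegral_mono_ae ?_
    filter_upwards [hV] with y hy
    by_cases hxy : ‖x‖ < ‖y‖
    · have hy0 : 0 < ‖y‖ := hx0.trans hxy
      have hp : 0 < ‖y‖ ^ (-γ) := Real.rpow_pos_of_pos hy0 _
      simp only [hF, indicator_of_mem (mem_Ioi.2 hxy)]
      have e1 : ‖gradient φ y‖ₑ ^ 2 = ENNReal.ofReal (‖gradient φ y‖ ^ 2) := by
        rw [← ofReal_norm, ENNReal.ofReal_pow (norm_nonneg _)]
      have e2 : ‖φ y‖ₑ ^ 2 = ENNReal.ofReal (f ‖y‖ ^ 2) := by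
        rw [← ofReal_norm, ← ENNReal.ofReal_pow (norm_nonneg _), hφf, Real.norm_eq_abs, sq_abs]
      rw [e1, e2, ← ENNReal.ofReal_mul hc.le]
      refine le_trans ?_ (add_le_add le_rfl (mul_le_mul_left (hy (hx.trans hxy)) _))
      rw [← ENNReal.ofReal_mul (by positivity), ← ENNReal.ofReal_add (by positivity)
        (by positivity)]
      refine ENNReal.ofReal_le_ofReal ?_
      have h1 := hgrad y (norm_pos_iff.1 hy0)
      have h2 : deriv f ‖y‖ ^ 2 ≤ ‖gradient φ y‖ ^ 2 := by
        rw [← sq_abs]; exact pow_le_pow_left₀ (abs_nonneg _) h1 2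
      nlinarith [sq_nonneg (deriv f ‖y‖)]
    · simp [hF, hxy]
  refine le_trans ?_ hstep
  rw [lintegral_fun_norm (by omega) hFm]
  refine mul_le_mul_right ?_ _
  have hcast : ((N - 1 : ℕ) : ℝ) = N - 1 := by
    rw [Nat.cast_sub (by omega)]; simp
  have hN' : (3 : ℝ) ≤ N := by exact_mod_cast hN
  have hdec := profile_decay hf hfc (n := N - 1) (γ := γ) hx0 (by rw [hcast]; linarith)
  rw [hcast, ← hφf] at hdec
  rw [ENNReal.ofReal_mul hc.le]
  refine (mul_le_mul_right hdec _).trans ?_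
  rw [← lintegral_const_mul _ (by
    have := hf.continuous.measurable
    have := hf'.measurable
    fun_prop)]
  rw [← lintegral_indicator measurableSet_Ioi, ← lintegral_indicator measurableSet_Ioi]
  refine lintegral_mono fun s => ?_
  by_cases hs : ‖x‖ < s
  · have hs0 : (0 : ℝ) < s := hx0.trans hs
    simp only [hF, indicator_of_mem (mem_Ioi.2 hs), indicator_of_mem (mem_Ioi.2 hs0)]
    exact le_of_eq (by ring)
  · simp [hs]

lemma hNorm_sq {N : ℕ} (V : ℝ → ℝ≥0∞) (u : E N → ℝ) :
    hNorm V u ^ 2 = ∫⁻ x, (‖weakGradient u x‖ₑ ^ 2 + V ‖x‖ * ‖u x‖ₑ ^ 2) := by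
  rw [hNorm, ← ENNReal.rpow_two, ← ENNReal.rpow_mul]
  norm_num

lemma add_sq_le_two_mul (a b : ℝ≥0∞) : (a + b) ^ 2 ≤ 2 * a ^ 2 + 2 * b ^ 2 := by
  have := ENNReal.rpow_add_le_mul_rpow_add_rpow a b (p := 2) (by norm_num)
  norm_num at this
  rw [mul_add] at this
  exact_mod_cast this

/-- Energy bound for a test function near an element of unit energy. -/
lemma energy_le_of_hNorm_sub_le {N : ℕ} {V : ℝ → ℝ≥0∞}
    (hVm : AEMeasurable (fun x : E N => V ‖x‖) volume) {u φ : E N → ℝ}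
    (hex : ∃ G : E N → E N, HasWeakGradient u G)
    (hum : AEStronglyMeasurable u volume) (hgm : AEStronglyMeasurable (weakGradient u) volume)
    (hu : ∫⁻ x, (‖weakGradient u x‖ₑ ^ 2 + V ‖x‖ * ‖u x‖ₑ ^ 2) = 1)
    (hφ : IsTestFunction φ)
    (hlt : ∫⁻ x, (‖weakGradient (u - φ) x‖ₑ ^ 2 + V ‖x‖ * ‖(u - φ) x‖ₑ ^ 2) ≤ 1) :
    ∫⁻ x, (‖gradient φ x‖ₑ ^ 2 + V ‖x‖ * ‖φ x‖ₑ ^ 2) ≤ 4 := by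
  have hm : AEMeasurable (fun x => 2 * (‖weakGradient u x‖ₑ ^ 2 + V ‖x‖ * ‖u x‖ₑ ^ 2)) volume :=
    ((hgm.enorm.pow_const 2).add (hVm.mul (hum.enorm.pow_const 2))).const_mul 2
  calc ∫⁻ x, (‖gradient φ x‖ₑ ^ 2 + V ‖x‖ * ‖φ x‖ₑ ^ 2)
      ≤ ∫⁻ x, (2 * (‖weakGradient u x‖ₑ ^ 2 + V ‖x‖ * ‖u x‖ₑ ^ 2) +
          2 * (‖weakGradient (u - φ) x‖ₑ ^ 2 + V ‖x‖ * ‖(u - φ) x‖ₑ ^ 2)) := by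
        refine lintegral_mono_ae ?_
        filter_upwards [weakGradient_sub_ae hex hφ] with x hx
        have g1 : gradient φ x = weakGradient u x - weakGradient (u - φ) x := by
          rw [hx, sub_sub_cancel]
        have g2 : φ x = u x - (u - φ) x := by simp
        have g3 : ‖gradient φ x‖ₑ ^ 2 ≤
            2 * ‖weakGradient u x‖ₑ ^ 2 + 2 * ‖weakGradient (u - φ) x‖ₑ ^ 2 := by
          rw [g1]; exact (pow_le_pow_left' enorm_sub_le 2).trans (add_sq_le_two_mul _ _)
        have g4 : ‖φ x‖ₑ ^ 2 ≤ 2 * ‖u x‖ₑ ^ 2 + 2 * ‖(u - φ) x‖ₑ ^ 2 := by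
          conv_lhs => rw [g2]
          exact (pow_le_pow_left' enorm_sub_le 2).trans (add_sq_le_two_mul _ _)
        refine (add_le_add g3 (mul_le_mul_right g4 _)).trans (le_of_eq ?_)
        ring
    _ = 2 * 1 + 2 * ∫⁻ x, (‖weakGradient (u - φ) x‖ₑ ^ 2 + V ‖x‖ * ‖(u - φ) x‖ₑ ^ 2) := by
        rw [lintegral_add_left' hm, lintegral_const_mul' _ _ (by simp),
          lintegral_const_mul' _ _ (by simp), hu]
    _ ≤ 2 * 1 + 2 * 1 := by gcongr
    _ = 4 := by norm_num

/-- Pointwise decay of the elements of the radial space. -/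
lemma MemHrad.decay {N : ℕ} (hN : 3 ≤ N) {V : ℝ → ℝ≥0∞} {R₂ γ c : ℝ}
    (hR₂ : 0 < R₂) (hγ : γ ≤ 2) (hc : 0 < c) (hc1 : c ≤ 1)
    (hVm : AEMeasurable (fun x : E N => V ‖x‖) volume)
    (hV : ∀ᵐ x : E N, R₂ < ‖x‖ → ENNReal.ofReal (c * ‖x‖ ^ (-γ)) ≤ V ‖x‖) :
    ∃ D : ℝ, 0 < D ∧ ∀ u : E N → ℝ, MemHrad V u → hNorm V u = 1 →
      ∀ᵐ x : E N, R₂ < ‖x‖ → |u x| ≤ D * ‖x‖ ^ (-((N - 1 - γ / 2) / 2)) := by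
  have : Nonempty (Fin N) := ⟨⟨0, by omega⟩⟩
  set σ := (volume : Measure (E N)).toSphere univ with hσ
  have hσ0 : σ ≠ 0 := by
    rw [hσ, Measure.measure_univ_ne_zero]; exact Measure.toSphere_ne_zero _
  have hσt : σ ≠ ∞ := measure_ne_top _ _
  have hσp : 0 < σ.toReal := ENNReal.toReal_pos hσ0 hσt
  refine ⟨√(4 / (σ.toReal * c)), by positivity, fun u hu hu1 => ?_⟩
  set D := √(4 / (σ.toReal * c)) with hD
  set b : ℝ := (N - 1 - γ / 2) / 2 with hb
  have hex := hu.1.1.2.1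
  have hum : AEStronglyMeasurable u volume := hu.1.1.1.1
  have hgm : AEStronglyMeasurable (weakGradient u) volume := hu.1.1.2.2.1
  have hu1' : ∫⁻ x, (‖weakGradient u x‖ₑ ^ 2 + V ‖x‖ * ‖u x‖ₑ ^ 2) = 1 := by
    rw [← hNorm_sq, hu1, one_pow]
  set w : E N → ℝ≥0∞ := fun x => {y : E N | R₂ < ‖y‖}.indicator
    (fun x => ENNReal.ofReal (c * ‖x‖ ^ (-γ)) *
      (‖u x‖ₑ - ENNReal.ofReal (D * ‖x‖ ^ (-b))) ^ 2) x with hw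
  have hset : MeasurableSet {y : E N | R₂ < ‖y‖} := measurableSet_lt measurable_const measurable_norm
  have hwm : AEMeasurable w volume := by
    refine AEMeasurable.indicator ?_ hset
    have := hum.enorm
    fun_prop
  have hsmall : ∀ ε : ℝ≥0∞, 0 < ε → ε ≤ 1 → ∫⁻ x, w x ≤ ε ^ 2 := by
    intro ε hε hε1
    obtain ⟨φ, hφ, hrad, -, hlt⟩ := hu.2 ε hε
    have hlt' : ∫⁻ x, (‖weakGradient (u - φ) x‖ₑ ^ 2 + V ‖x‖ * ‖(u - φ) x‖ₑ ^ 2) ≤ ε ^ 2 := by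
      rw [← hNorm_sq]; exact pow_le_pow_left' hlt.le 2
    have hφE := energy_le_of_hNorm_sub_le hVm hex hum hgm hu1' hφ (hlt'.trans (pow_le_one' hε1 2))
    have hpt : ∀ x : E N, R₂ < ‖x‖ → |φ x| ≤ D * ‖x‖ ^ (-b) := by
      intro x hx
      have hx0 : 0 < ‖x‖ := hR₂.trans hx
      have h1 := (hφ.radial_decay hN hR₂ hγ hc hc1 hV hrad hx).trans hφE
      rw [← hσ, ← ENNReal.ofReal_toReal hσt, ← ENNReal.ofReal_mul hσp.le,
        show (4 : ℝ≥0∞) = ENNReal.ofReal 4 by simp,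
        ENNReal.ofReal_le_ofReal_iff (by norm_num)] at h1
      have e1 : ‖x‖ ^ ((N : ℝ) - 1 - γ / 2) = (‖x‖ ^ b) ^ 2 := by
        rw [← Real.rpow_natCast, ← Real.rpow_mul hx0.le, hb]; congr 1; push_cast; ring
      have hbp : 0 < ‖x‖ ^ b := Real.rpow_pos_of_pos hx0 _
      rw [Real.rpow_neg hx0.le, ← div_eq_mul_inv, le_div_iff₀ hbp]
      refine Real.le_sqrt_of_sq_le ?_
      rw [le_div_iff₀ (by positivity), mul_pow, sq_abs]
      rw [e1] at h1
      linarith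
    refine le_trans (lintegral_mono_ae ?_) hlt'
    filter_upwards [hV] with x hx
    by_cases hxR : R₂ < ‖x‖
    · have hmem : x ∈ {y : E N | R₂ < ‖y‖} := hxR
      simp only [hw, indicator_of_mem hmem]
      refine le_trans (mul_le_mul' (hx hxR) (pow_le_pow_left' ?_ 2)) le_add_self
      rw [tsub_le_iff_right]
      have h2 : ‖φ x‖ₑ ≤ ENNReal.ofReal (D * ‖x‖ ^ (-b)) := by
        rw [← ofReal_norm, Real.norm_eq_abs]
        exact ENNReal.ofReal_le_ofReal (hpt x hxR)
      calc ‖u x‖ₑ = ‖(u - φ) x + φ x‖ₑ := by simp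
        _ ≤ ‖(u - φ) x‖ₑ + ‖φ x‖ₑ := enorm_add_le _ _
        _ ≤ _ := add_le_add le_rfl h2
    · simp [hw, hxR]
  have hzero : ∫⁻ x, w x = 0 := by
    refine le_antisymm (le_of_forall_pos_le_add fun ε hε => ?_) zero_le
    have hm : 0 < min ε 1 := lt_min hε one_pos
    refine (hsmall (min ε 1) hm (min_le_right _ _)).trans ?_
    rw [zero_add, sq]
    calc min ε 1 * min ε 1 ≤ ε * 1 := mul_le_mul' (min_le_left _ _) (min_le_right _ _)
      _ = ε := mul_one _
  rw [lintegral_eq_zero_iff' hwm] at hzero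
  filter_upwards [hzero] with x hx hxR
  have hx0 : 0 < ‖x‖ := hR₂.trans hxR
  have hmem : x ∈ {y : E N | R₂ < ‖y‖} := hxR
  simp only [hw, indicator_of_mem hmem, Pi.zero_apply, mul_eq_zero] at hx
  have hp : 0 < ‖x‖ ^ (-γ) := Real.rpow_pos_of_pos hx0 _
  rcases hx with hx | hx
  · exact absurd hx (by simp only [ENNReal.ofReal_eq_zero, not_le]; positivity)
  · rw [sq_eq_zero_iff, tsub_eq_zero_iff_le, ← ofReal_norm, Real.norm_eq_abs,
      ENNReal.ofReal_le_ofReal_iff (by positivity)] at hx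
    exact hx

/-- Raising the exponent of the potential at the price of a power of the radius. -/
lemma rpow_le_of_lower_bound {c r v γ β p : ℝ} (hc : 0 < c) (hr : 0 < r)
    (hv : c * r ^ (-γ) ≤ v) (hp : β ≤ p) :
    v ^ β ≤ c ^ (-(p - β)) * r ^ (γ * (p - β)) * v ^ p := by
  have hrγ : 0 < r ^ (-γ) := Real.rpow_pos_of_pos hr _
  have hv0 : 0 < v := (mul_pos hc hrγ).trans_le hv
  have h1 := Real.rpow_le_rpow (by positivity) hv (sub_nonneg.2 hp)
  rw [Real.mul_rpow hc.le hrγ.le, ← Real.rpow_mul hr.le] at h1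
  have e1 : v ^ p = v ^ β * v ^ (p - β) := by rw [← Real.rpow_add hv0]; congr 1; ring
  have e2 : c ^ (-(p - β)) * c ^ (p - β) = 1 := by rw [← Real.rpow_add hc]; simp
  have e3 : r ^ (γ * (p - β)) * r ^ (-γ * (p - β)) = 1 := by rw [← Real.rpow_add hr]; simp
  calc v ^ β = c ^ (-(p - β)) * r ^ (γ * (p - β)) * (v ^ β *
        (c ^ (p - β) * r ^ (-γ * (p - β)))) := by
        linear_combination (-v ^ β) * e2 - v ^ β * c ^ (-(p - β)) * c ^ (p - β) * e3
    _ ≤ c ^ (-(p - β)) * r ^ (γ * (p - β)) * v ^ p := by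
        rw [e1]; gcongr

/-- Young-type inequality with exponents summing to two. -/
lemma mul_rpow_mul_rpow_le {a b t q : ℝ} (ha : 0 ≤ a) (hb : 0 ≤ b) (ht : 0 ≤ t)
    (hq1 : 1 ≤ q) (hq2 : q ≤ 2) :
    a ^ (q - 1) * b * t ^ (2 - q) ≤ a ^ 2 + b ^ 2 + t ^ 2 := by
  set m := max a (max b t) with hm
  have ham : a ≤ m := le_max_left _ _
  have hbm : b ≤ m := (le_max_left _ _).trans (le_max_right _ _)
  have htm : t ≤ m := (le_max_right _ _).trans (le_max_right _ _)
  have hm0 : 0 ≤ m := ha.trans ham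
  have hle : m ^ 2 ≤ a ^ 2 + b ^ 2 + t ^ 2 := by
    rcases max_choice a (max b t) with h | h
    · rw [hm, h]; nlinarith [sq_nonneg b, sq_nonneg t]
    · rcases max_choice b t with h' | h' <;> rw [hm, h, h'] <;>
        nlinarith [sq_nonneg a, sq_nonneg b, sq_nonneg t]
  refine le_trans ?_ hle
  calc a ^ (q - 1) * b * t ^ (2 - q) ≤ m ^ (q - 1) * m * m ^ (2 - q) := by
        gcongr
    _ = m ^ 2 := by
        rcases hm0.eq_or_lt with h | h
        · rw [← h]; simp
        · rw [mul_right_comm, ← Real.rpow_add h, ← Real.rpow_natCast m 2]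
          norm_num [sq]

/-- Pointwise bound of the integrand for `q ≥ 2`. -/
lemma integrand_le_of_two_le {α β γ ν q c L D r v k a b : ℝ} (hβ₁ : β ≤ 1) (hq : 2 ≤ q)
    (hc : 0 < c) (hL : 0 ≤ L) (hD : 0 ≤ D) (hr : 0 < r) (hv : c * r ^ (-γ) ≤ v)
    (hk : k ≤ L * (r ^ α * v ^ β)) (ha : 0 ≤ a) (hb : 0 ≤ b) (haD : a ≤ D * r ^ (-ν)) :
    k * a ^ (q - 1) * b ≤ L * c ^ (-(1 - β)) * D ^ (q - 2) *
      r ^ (-(ν * (q - 2) - α - γ * (1 - β))) * (v * a ^ 2 + v * b ^ 2) := by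
  have hv0 : 0 < v := (mul_pos hc (Real.rpow_pos_of_pos hr _)).trans_le hv
  have h1 := rpow_le_of_lower_bound hc hr hv hβ₁
  rw [Real.rpow_one] at h1
  have h2 : a ^ (q - 1) ≤ D ^ (q - 2) * r ^ (-ν * (q - 2)) * a := by
    rcases ha.eq_or_lt with h | h
    · rw [← h, Real.zero_rpow (by linarith)]; simp
    · have : a ^ (q - 1) = a ^ (q - 2) * a := by
        rw [← Real.rpow_add_one h.ne']; congr 1; ring
      rw [this, Real.rpow_mul hr.le, ← Real.mul_rpow hD (by positivity)]
      gcongr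
  have h3 : a * b ≤ a ^ 2 + b ^ 2 := by nlinarith [sq_nonneg (a - b), sq_nonneg a, sq_nonneg b]
  have e1 : r ^ (-(ν * (q - 2) - α - γ * (1 - β))) =
      r ^ α * r ^ (γ * (1 - β)) * r ^ (-ν * (q - 2)) := by
    rw [← Real.rpow_add hr, ← Real.rpow_add hr]; congr 1; ring
  calc k * a ^ (q - 1) * b
      ≤ L * (r ^ α * (c ^ (-(1 - β)) * r ^ (γ * (1 - β)) * v)) *
        (D ^ (q - 2) * r ^ (-ν * (q - 2)) * a) * b := by
        refine mul_le_mul_of_nonneg_right ?_ hb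
        refine mul_le_mul (hk.trans ?_) h2 (by positivity) (by positivity)
        gcongr
    _ = L * c ^ (-(1 - β)) * D ^ (q - 2) * r ^ (-(ν * (q - 2) - α - γ * (1 - β))) *
          (v * (a * b)) := by rw [e1]; ring
    _ ≤ _ := by
        rw [← mul_add]
        gcongr

/-- Pointwise bound of the integrand for `1 < q < 2`. -/
lemma integrand_le_of_lt_two {α β γ n ε q c L r v k a b : ℝ} (hq1 : 1 < q) (hq2 : q < 2)
    (hβ : 2 * β ≤ q) (hc : 0 < c) (hL : 0 ≤ L) (hr : 0 < r) (hv : c * r ^ (-γ) ≤ v)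
    (hk : k ≤ L * (r ^ α * v ^ β)) (ha : 0 ≤ a) (hb : 0 ≤ b)
    (hε : 2 * ε = -(α + γ * (q / 2 - β)) - n * (2 - q) / 2) :
    k * a ^ (q - 1) * b ≤ L * c ^ (-(q / 2 - β)) * r ^ (-ε) *
      (v * a ^ 2 + v * b ^ 2 + r ^ (-(n + 2 * ε / (2 - q)))) := by
  have hv0 : 0 < v := (mul_pos hc (Real.rpow_pos_of_pos hr _)).trans_le hv
  have h1 := rpow_le_of_lower_bound hc hr hv (show β ≤ q / 2 by linarith)
  set s := √v with hs
  have hs0 : 0 < s := Real.sqrt_pos.2 hv0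
  have hsv : s ^ 2 = v := Real.sq_sqrt hv0.le
  set t := r ^ (-(n + 2 * ε / (2 - q)) / 2) with ht
  have ht0 : 0 < t := Real.rpow_pos_of_pos hr _
  have ht2 : t ^ 2 = r ^ (-(n + 2 * ε / (2 - q))) := by
    rw [ht, ← Real.rpow_natCast, ← Real.rpow_mul hr.le]; congr 1; push_cast; ring
  have hq : (2 - q) ≠ 0 := by linarith
  have htq : t ^ (2 - q) = r ^ (α + γ * (q / 2 - β) + ε) := by
    rw [ht, ← Real.rpow_mul hr.le]; congr 1
    field_simp
    linear_combination (-2) * hε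
  have hvq : v ^ (q / 2) = s ^ (q - 1) * s := by
    rw [← Real.rpow_add_one hs0.ne', ← hsv, ← Real.rpow_natCast, ← Real.rpow_mul hs0.le]
    congr 1; push_cast; ring
  have hy := mul_rpow_mul_rpow_le (mul_nonneg hs0.le ha) (mul_nonneg hs0.le hb) ht0.le
    hq1.le hq2.le
  rw [Real.mul_rpow hs0.le ha, mul_pow, mul_pow, hsv, ht2, htq] at hy
  have e1 : r ^ α * r ^ (γ * (q / 2 - β)) = r ^ (-ε) * r ^ (α + γ * (q / 2 - β) + ε) := by
    rw [← Real.rpow_add hr, ← Real.rpow_add hr]; congr 1; ring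
  calc k * a ^ (q - 1) * b
      ≤ L * (r ^ α * (c ^ (-(q / 2 - β)) * r ^ (γ * (q / 2 - β)) * v ^ (q / 2))) *
        a ^ (q - 1) * b := by
        refine mul_le_mul_of_nonneg_right ?_ hb
        refine mul_le_mul_of_nonneg_right (hk.trans ?_) (by positivity)
        gcongr
    _ = L * c ^ (-(q / 2 - β)) * r ^ (-ε) *
          (s ^ (q - 1) * a ^ (q - 1) * (s * b) * r ^ (α + γ * (q / 2 - β) + ε)) := by
        rw [hvq]
        linear_combination (L * c ^ (-(q / 2 - β)) * s ^ (q - 1) * s * a ^ (q - 1) * b) * e1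
    _ ≤ _ := by gcongr

/-- The integrand decays, relative to the energy densities and an integrable power. -/
lemma exists_integrand_le {N : ℕ} (hN : 3 ≤ N) {α β γ q c L D : ℝ} (hβ₁ : β ≤ 1) (hγ : γ ≤ 2)
    (hc : 0 < c) (hL : 0 ≤ L) (hD : 0 ≤ D) (hq1 : 1 < q) (hqβ : 2 * β < q)
    (hqs : qStar N α β γ < q) (hqss : qStarStar N α β γ < q) :
    ∃ ε M τ : ℝ, 0 < ε ∧ 0 ≤ M ∧ (N : ℝ) < τ ∧ ∀ r v k a b : ℝ, 0 < r → c * r ^ (-γ) ≤ v →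
      k ≤ L * (r ^ α * v ^ β) → 0 ≤ a → 0 ≤ b →
      a ≤ D * r ^ (-(((N : ℝ) - 1 - γ / 2) / 2)) →
      k * a ^ (q - 1) * b ≤ M * r ^ (-ε) * (v * a ^ 2 + v * b ^ 2 + r ^ (-τ)) := by
  have hN' : (3 : ℝ) ≤ N := by exact_mod_cast hN
  rcases le_or_gt 2 q with hq | hq
  · refine ⟨((N : ℝ) - 1 - γ / 2) / 2 * (q - 2) - α - γ * (1 - β),
      L * c ^ (-(1 - β)) * D ^ (q - 2), N + 1, ?_, by positivity, by linarith, ?_⟩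
    · rw [qStarStar, ← mul_div_assoc, div_lt_iff₀ (by linarith)] at hqss
      linarith
    · intro r v k a b hr hv hk ha hb haD
      refine (integrand_le_of_two_le hβ₁ hq hc hL hD hr hv hk ha hb haD).trans ?_
      have := Real.rpow_nonneg hr.le (-((N : ℝ) + 1))
      refine mul_le_mul_of_nonneg_left (by linarith) (by positivity)
  · have hε : 0 < -(α + γ * (q / 2 - β)) - N * (2 - q) / 2 := by
      rw [qStar, ← mul_div_assoc, div_lt_iff₀ (by linarith)] at hqs
      linarith
    set ε := (-(α + γ * (q / 2 - β)) - N * (2 - q) / 2) / 2 with hεd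
    have hε0 : 0 < ε := by positivity
    refine ⟨ε, L * c ^ (-(q / 2 - β)), N + 2 * ε / (2 - q), hε0, by positivity, ?_, ?_⟩
    · have : 0 < 2 * ε / (2 - q) := div_pos (by linarith) (by linarith)
      linarith
    · intro r v k a b hr hv hk ha hb _
      exact integrand_le_of_lt_two hq1 hq hqβ.le hc hL hr hv hk ha hb (by rw [hεd]; ring)

lemma lintegral_norm_rpow_compl_ball_lt_top {N : ℕ} {τ : ℝ} (hτ : (N : ℝ) < τ) :
    ∫⁻ x in (Metric.ball (0 : E N) 1)ᶜ, ENNReal.ofReal (‖x‖ ^ (-τ)) < ∞ := by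
  have hfin := finite_integral_one_add_norm (E := E N) (μ := volume) (r := τ) (by simpa using hτ)
  have hτ0 : 0 ≤ τ := (Nat.cast_nonneg N).trans hτ.le
  have hle : ∫⁻ x in (Metric.ball (0 : E N) 1)ᶜ, ENNReal.ofReal (‖x‖ ^ (-τ)) ≤
      ∫⁻ x : E N, ENNReal.ofReal (2 ^ τ) * ENNReal.ofReal ((1 + ‖x‖) ^ (-τ)) := by
    refine (setLIntegral_mono' measurableSet_ball.compl fun x hx => ?_).trans
      (setLIntegral_le_lintegral _ _)
    have hx1 : 1 ≤ ‖x‖ := by simpa using hx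
    have hx0 : 0 < ‖x‖ := by linarith
    rw [← ENNReal.ofReal_mul (by positivity)]
    refine ENNReal.ofReal_le_ofReal ?_
    rw [Real.rpow_neg hx0.le, Real.rpow_neg (by positivity), ← div_eq_mul_inv,
      ← Real.div_rpow (by norm_num) (by positivity), ← Real.inv_rpow hx0.le]
    refine Real.rpow_le_rpow (by positivity) ?_ hτ0
    rw [inv_eq_one_div, div_le_div_iff₀ hx0 (by positivity)]
    linarith
  refine hle.trans_lt ?_
  rw [lintegral_const_mul' _ _ (by simp)]
  exact ENNReal.mul_lt_top (by simp) hfin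

lemma lintegral_potential_le_of_hNorm_eq_one {N : ℕ} {V : ℝ → ℝ≥0∞} {u : E N → ℝ}
    (hu : hNorm V u = 1) : ∫⁻ x, V ‖x‖ * ‖u x‖ₑ ^ 2 ≤ 1 := by
  have h := hNorm_sq V u
  rw [hu, one_pow] at h
  rw [h]
  exact lintegral_mono fun x => le_add_self

/-- The essential bounds on `V` and `K`, transferred to `ℝ^N` with real constants. -/
lemma exists_potential_bounds {N : ℕ} (hN : 3 ≤ N) {V : ℝ → ℝ≥0∞} {K : ℝ → ℝ}
    (hK : ∀ r : ℝ, 0 < r → 0 < K r)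
    (hVfin : ∀ᵐ r ∂(volume.restrict (Ioi (0 : ℝ))), V r < ∞)
    {R₂ : ℝ} (hR₂ : 0 < R₂) {α β γ : ℝ}
    (hsup : essSup (fun r : ℝ => ENNReal.ofReal (K r) / (ENNReal.ofReal (r ^ α) * V r ^ β))
      (volume.restrict (Ioi R₂)) < ∞)
    (hinf : 0 < essInf (fun r : ℝ => ENNReal.ofReal (r ^ γ) * V r)
      (volume.restrict (Ioi R₂))) :
    ∃ c L : ℝ, 0 < c ∧ c ≤ 1 ∧ 0 ≤ L ∧ ∀ᵐ x : E N, R₂ < ‖x‖ → V ‖x‖ < ∞ ∧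
      c * ‖x‖ ^ (-γ) ≤ (V ‖x‖).toReal ∧ K ‖x‖ ≤ L * (‖x‖ ^ α * (V ‖x‖).toReal ^ β) := by
  set S := essSup (fun r : ℝ => ENNReal.ofReal (K r) / (ENNReal.ofReal (r ^ α) * V r ^ β))
      (volume.restrict (Ioi R₂)) with hS
  set I := essInf (fun r : ℝ => ENNReal.ofReal (r ^ γ) * V r) (volume.restrict (Ioi R₂)) with hI
  have hm1 : min I 1 ≠ ∞ := ((min_le_right _ _).trans_lt ENNReal.one_lt_top).ne
  have hm0 : 0 < min I 1 := lt_min hinf one_pos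
  refine ⟨(min I 1).toReal, S.toReal, ENNReal.toReal_pos hm0.ne' hm1, ?_, ENNReal.toReal_nonneg, ?_⟩
  · simpa using ENNReal.toReal_mono ENNReal.one_ne_top (min_le_right I 1)
  have h1 : ∀ᵐ r ∂(volume.restrict (Ioi R₂)), _ ≤ S := ENNReal.ae_le_essSup _
  have h2 : ∀ᵐ r ∂(volume.restrict (Ioi R₂)), I ≤ ENNReal.ofReal (r ^ γ) * V r := ae_essInf_le
  have h3 : ∀ᵐ r ∂(volume.restrict (Ioi R₂)), V r < ∞ :=
    ae_mono (Measure.restrict_mono (Ioi_subset_Ioi hR₂.le) le_rfl) hVfin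
  filter_upwards [ae_norm_of_ae_Ioi (N := N) (by omega) h1, ae_norm_of_ae_Ioi (N := N) (by omega) h2,
    ae_norm_of_ae_Ioi (N := N) (by omega) h3] with x g1 g2 g3 hx
  have hx0 : 0 < ‖x‖ := hR₂.trans hx
  specialize g1 hx
  specialize g2 hx
  specialize g3 hx
  set r := ‖x‖ with hr
  have hrγ : 0 < r ^ γ := Real.rpow_pos_of_pos hx0 _
  have hrα : 0 < r ^ α := Real.rpow_pos_of_pos hx0 _
  have hlow : (min I 1).toReal ≤ r ^ γ * (V r).toReal := by
    have := ENNReal.toReal_mono (ENNReal.mul_ne_top ENNReal.ofReal_ne_top g3.ne)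
      ((min_le_left I 1).trans g2)
    rwa [ENNReal.toReal_mul, ENNReal.toReal_ofReal hrγ.le] at this
  have hVr : V r ≠ 0 := by
    intro h0
    rw [h0, mul_zero] at g2
    exact absurd hinf (not_lt.2 g2)
  have hv0 : 0 < (V r).toReal := ENNReal.toReal_pos hVr g3.ne
  refine ⟨g3, ?_, ?_⟩
  · rw [Real.rpow_neg hx0.le, ← div_eq_mul_inv, div_le_iff₀ hrγ]
    linarith
  · have hVv : V r ^ β = ENNReal.ofReal ((V r).toReal ^ β) := by
      rw [← ENNReal.ofReal_rpow_of_pos hv0, ENNReal.ofReal_toReal g3.ne]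
    have hp : 0 < r ^ α * (V r).toReal ^ β := mul_pos hrα (Real.rpow_pos_of_pos hv0 _)
    rw [hVv, ← ENNReal.ofReal_mul hrα.le, ← ENNReal.ofReal_div_of_pos hp] at g1
    have := ENNReal.toReal_mono hsup.ne g1
    rw [ENNReal.toReal_ofReal (div_nonneg (hK r hx0).le hp.le), div_le_iff₀ hp] at this
    exact this

/-- `𝓡_∞(q, R)` vanishes as `R → ∞` for `q` above the critical exponents. -/
theorem tendsto_Rinfty_atTop (N : ℕ) (hN : 3 ≤ N) (V : ℝ → ℝ≥0∞) (K : ℝ → ℝ)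
    (hV : AssumptionV V) (hK : AssumptionK N K)
    (hVfin : ∀ᵐ r ∂(volume.restrict (Ioi (0 : ℝ))), V r < ∞)
    (R₂ : ℝ) (hR₂ : 0 < R₂) (α β γ : ℝ) (hβ₁ : β ≤ 1) (hγ : γ ≤ 2)
    (hsup : essSup (fun r : ℝ => ENNReal.ofReal (K r) / (ENNReal.ofReal (r ^ α) * V r ^ β))
      (volume.restrict (Ioi R₂)) < ∞)
    (hinf : 0 < essInf (fun r : ℝ => ENNReal.ofReal (r ^ γ) * V r)
      (volume.restrict (Ioi R₂)))
    (q₂ : ℝ)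
    (hq₂ : max 1 (max (2 * β)
      (max (qStar N α β γ) (qStarStar N α β γ))) < q₂) :
    Tendsto (fun R : ℝ => Rinfty N V K q₂ R) atTop (𝓝 0) := by
  simp only [max_lt_iff] at hq₂
  obtain ⟨hq1, hqβ, hqs, hqss⟩ := hq₂
  obtain ⟨c, L, hc, hc1, hL, hbd⟩ :=
    exists_potential_bounds hN (β := β) hK.1 hVfin hR₂ hsup hinf
  have hVm : AEMeasurable (fun x : E N => V ‖x‖) volume :=
    aemeasurable_comp_norm (by omega) hV.1
  have hVlow : ∀ᵐ x : E N, R₂ < ‖x‖ → ENNReal.ofReal (c * ‖x‖ ^ (-γ)) ≤ V ‖x‖ := by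
    filter_upwards [hbd] with x hx hxR
    exact ENNReal.ofReal_le_of_le_toReal (hx hxR).2.1
  obtain ⟨D, hD, hdecay⟩ := MemHrad.decay hN hR₂ hγ hc hc1 hVm hVlow
  obtain ⟨ε, M, τ, hε, hM, hτ, hpt⟩ := exists_integrand_le hN (c := c) (L := L) (D := D)
    hβ₁ hγ hc hL hD.le hq1 hqβ hqs hqss
  set C := ∫⁻ x in (Metric.ball (0 : E N) 1)ᶜ, ENNReal.ofReal (‖x‖ ^ (-τ))
  have hCfin : C < ∞ := lintegral_norm_rpow_compl_ball_lt_top hτ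
  have hbound : ∀ R : ℝ, max R₂ 1 < R →
      Rinfty N V K q₂ R ≤ ENNReal.ofReal (M * R ^ (-ε)) * (1 + 1 + C) := by
    intro R hR
    have hR2 : R₂ < R := (le_max_left _ _).trans_lt hR
    have hR1 : 1 < R := (le_max_right _ _).trans_lt hR
    refine iSup_le fun u => iSup_le fun h => iSup_le fun hu => iSup_le fun hh =>
      iSup_le fun hu1 => iSup_le fun hh1 => ?_
    have hum : AEStronglyMeasurable u volume := hu.1.1.1.1
    have hhm : AEStronglyMeasurable h volume := hh.1.1.1
    calc ∫⁻ x in (Metric.ball (0 : E N) R)ᶜ,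
          ENNReal.ofReal (K ‖x‖) * ‖u x‖ₑ ^ (q₂ - 1) * ‖h x‖ₑ
        ≤ ∫⁻ x in (Metric.ball (0 : E N) R)ᶜ, ENNReal.ofReal (M * R ^ (-ε)) *
            (V ‖x‖ * ‖u x‖ₑ ^ 2 + V ‖x‖ * ‖h x‖ₑ ^ 2 + ENNReal.ofReal (‖x‖ ^ (-τ))) := by
          refine setLIntegral_mono_ae' measurableSet_ball.compl ?_
          filter_upwards [hbd, hdecay u hu hu1] with x hx hux hxR
          have hxR' : R ≤ ‖x‖ := by simpa using hxR
          have hx2 : R₂ < ‖x‖ := hR2.trans_le hxR'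
          have hx0 : 0 < ‖x‖ := hR₂.trans hx2
          obtain ⟨hfin, hlow, hKx⟩ := hx hx2
          have hmain := hpt ‖x‖ (V ‖x‖).toReal (K ‖x‖) |u x| |h x| hx0 hlow hKx
            (abs_nonneg _) (abs_nonneg _) (hux hx2)
          have hpow : ‖x‖ ^ (-ε) ≤ R ^ (-ε) :=
            Real.rpow_le_rpow_of_nonpos (by linarith) hxR' (by linarith)
          have hvn : 0 ≤ (V ‖x‖).toReal := ENNReal.toReal_nonneg
          have hτn : 0 ≤ ‖x‖ ^ (-τ) := Real.rpow_nonneg hx0.le _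
          have hmain' := hmain.trans (mul_le_mul_of_nonneg_right
            (mul_le_mul_of_nonneg_left hpow hM) (by positivity))
          have hKn := (hK.1 _ hx0).le
          rw [← ENNReal.ofReal_toReal hfin.ne, ← ofReal_norm, ← ofReal_norm, Real.norm_eq_abs,
            Real.norm_eq_abs, ENNReal.ofReal_rpow_of_nonneg (abs_nonneg _) (by linarith),
            ← ENNReal.ofReal_mul hKn, ← ENNReal.ofReal_mul (by positivity),
            ← ENNReal.ofReal_pow (abs_nonneg _), ← ENNReal.ofReal_pow (abs_nonneg _),
            ← ENNReal.ofReal_mul hvn, ← ENNReal.ofReal_mul hvn,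
            ← ENNReal.ofReal_add (by positivity) (by positivity),
            ← ENNReal.ofReal_add (by positivity) hτn, ← ENNReal.ofReal_mul (by positivity)]
          exact ENNReal.ofReal_le_ofReal hmain'
      _ = ENNReal.ofReal (M * R ^ (-ε)) *
            (∫⁻ x in (Metric.ball (0 : E N) R)ᶜ, V ‖x‖ * ‖u x‖ₑ ^ 2) +
          ENNReal.ofReal (M * R ^ (-ε)) *
            (∫⁻ x in (Metric.ball (0 : E N) R)ᶜ, V ‖x‖ * ‖h x‖ₑ ^ 2) +
          ENNReal.ofReal (M * R ^ (-ε)) *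
            ∫⁻ x in (Metric.ball (0 : E N) R)ᶜ, ENNReal.ofReal (‖x‖ ^ (-τ)) := by
          have m1 : AEMeasurable (fun x => V ‖x‖ * ‖u x‖ₑ ^ 2)
              (volume.restrict (Metric.ball (0 : E N) R)ᶜ) :=
            (hVm.mul (hum.enorm.pow_const 2)).restrict
          have m2 : AEMeasurable (fun x => V ‖x‖ * ‖h x‖ₑ ^ 2)
              (volume.restrict (Metric.ball (0 : E N) R)ᶜ) :=
            (hVm.mul (hhm.enorm.pow_const 2)).restrict
          have m12 : AEMeasurable (fun x => V ‖x‖ * ‖u x‖ₑ ^ 2 + V ‖x‖ * ‖h x‖ₑ ^ 2)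
              (volume.restrict (Metric.ball (0 : E N) R)ᶜ) := m1.add m2
          rw [lintegral_const_mul' _ _ ENNReal.ofReal_ne_top, lintegral_add_left' m12,
            lintegral_add_left' m1, mul_add, mul_add]
      _ ≤ ENNReal.ofReal (M * R ^ (-ε)) * 1 + ENNReal.ofReal (M * R ^ (-ε)) * 1 +
          ENNReal.ofReal (M * R ^ (-ε)) * C := by
          gcongr
          · exact (setLIntegral_le_lintegral _ _).trans
              (lintegral_potential_le_of_hNorm_eq_one hu1)
          · exact (setLIntegral_le_lintegral _ _).trans
              (lintegral_potential_le_of_hNorm_eq_one hh1)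
          · exact lintegral_mono_set
              (compl_subset_compl.2 (Metric.ball_subset_ball hR1.le))
      _ = ENNReal.ofReal (M * R ^ (-ε)) * (1 + 1 + C) := by ring
  have hlim : Tendsto (fun R : ℝ => ENNReal.ofReal (M * R ^ (-ε)) * (1 + 1 + C)) atTop (𝓝 0) := by
    have h1 : Tendsto (fun R : ℝ => ENNReal.ofReal (M * R ^ (-ε))) atTop (𝓝 0) := by
      have := ENNReal.tendsto_ofReal ((tendsto_rpow_neg_atTop hε).const_mul M)
      simpa using this
    have h2 := ENNReal.Tendsto.mul_const (b := 1 + 1 + C) h1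
      (Or.inr (by simp [hCfin.ne]))
    simpa using h2
  refine tendsto_of_tendsto_of_tendsto_of_le_of_le' tendsto_const_nhds hlim
    (Eventually.of_forall fun _ => zero_le) ?_
  filter_upwards [eventually_gt_atTop (max R₂ 1)] with R hR
  exact hbound R hR

end RadialSobolev

theorem theorem2p5 (N : ℕ) (hN : 3 ≤ N) (V : ℝ → ℝ≥0∞) (K : ℝ → ℝ)
    (hV : RadialSobolev.AssumptionV V) (hK : RadialSobolev.AssumptionK N K)
    (hVfin : ∀ᵐ r ∂(volume.restrict (Ioi (0 : ℝ))), V r < ∞)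
    (R₂ : ℝ) (hR₂ : 0 < R₂) (α β γ : ℝ) (hβ₀ : 0 ≤ β) (hβ₁ : β ≤ 1) (hγ : γ ≤ 2)
    (hsup : essSup (fun r : ℝ => ENNReal.ofReal (K r) / (ENNReal.ofReal (r ^ α) * V r ^ β))
      (volume.restrict (Ioi R₂)) < ∞)
    (hinf : 0 < essInf (fun r : ℝ => ENNReal.ofReal (r ^ γ) * V r)
      (volume.restrict (Ioi R₂)))
    (q₂ : ℝ)
    (hq₂ : max 1 (max (2 * β)
      (max (RadialSobolev.qStar N α β γ) (RadialSobolev.qStarStar N α β γ))) < q₂) :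
    Tendsto (fun R : ℝ => RadialSobolev.Rinfty N V K q₂ R) atTop (𝓝 0) := by
  exact RadialSobolev.tendsto_Rinfty_atTop N hN V K hV hK hVfin R₂ hR₂ α β γ hβ₁ hγ hsup hinf q₂ hq₂
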